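/- Let $G$ be a $\sigma$-compact, locally compact, metrizable topological group, $\Gamma\subset G$ a discrete subgroup, $X=G/\Gamma$ with its Borel $\sigma$-algebra, and $\mu$ a Borel probability measure on $G$. The random walk on $X$ given by $\mu$ is $\Phi_n=Y_n\cdots Y_1x$ for $x\in X$ and i.i.d. $G$-valued $Y_1,Y_2,\dots$ with law $\mu$; its transition kernel is $P(x,\cdot)=\mu*\delta_x$. Definitions. - $\mu$ is *spread out* if $\mu^{*n}$ is not singular with respect to Haar measure on $G$ for some $n\ge1$. - $\mu$ is *adapted* (respectively *strongly adapted*) if the closed subgroup (respectively closed subsemigroup) of $G$ generated by $\operatorname{supp}\mu$ is $G$. It is *$(G,\Gamma)$-adapted* if either $X$ carries a nonzero finite $G$-invariant Radon measure and $\mu$ is adapted, or $\mu$ is strongly adapted. - A nonzero measure $\varphi$ on $X$ is an *irreducibility measure* if $\mathbb P_x[\Phi_n\in A\text{ for some }n\ge1]>0$ for every $x\in X$ and every measurable $A\subset X$ with $\varphi(A)>0$. The walk is *$\psi$-irreducible* if $\psi$ is a probability measure on $X$ that is an irreducibility measure and every irreducibility measure is absolutely continuous with respect to $\psi$. - Let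 $\Delta$ be the modular character of $G$, $m_G(Ag)=\Delta(g)m_G(A)$ for left Haar measures $m_G$. For a continuous character $\chi:G\to\mathbb R_{>0}$ with $\chi|_\Gamma=\Delta|_\Gamma$ let $m_{X,\chi}$ denote a nonzero Radon measure on $X$ with $g_*m_{X,\chi}=\chi(g)m_{X,\chi}$ for all $g\in G$. All the $m_{X,\chi}$ have the same null sets; the *Haar measure class* $[m_X]$ is the class of measures with these null sets. It is *subinvariant* if it contains a $\sigma$-finite measure $\nu$ with $\nu P\le\nu$. For a measure $\psi$ on $X$, $\psi\ll[m_X]$ (respectively $[m_X]\ll\psi$) means that $\psi\ll m$ (respectively $m\ll\psi$) for the measures $m\in[m_X]$. **Proposition.** (i) If the random walk on $X$ given by $\mu$ is $\psi$-irreducible and $[m_X]$ is subinvariant, then $\mu$ is spread out and $\psi\ll[m_X]$. (ii) Conversely, if $\mu$ is spread out and $(G,\Gamma)$-adapted, then the random walk on $X$ given by $\mu$ is $\psi$-irreducible for some $\psi$, and $[m_X]\ll\psi$ for every such $\psi$. -/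

import Mathlib

open MeasureTheory

open scoped NNReal ENNReal Topology

namespace HomogeneousWalk

noncomputable section

section Increments

variable {G : Type*} [Group G] [TopologicalSpace G] [MeasurableSpace G]

/-- Convolution powers: `μ^{*0} = δ_e` and `μ^{*(n+1)} = μ * μ^{*n}`. -/
def convPow (μ : Measure G) : ℕ → Measure G
  | 0 => Measure.dirac 1
  | n + 1 => μ.mconv (convPow μ n)

/-- `μ` is spread out: some convolution power `μ^{*n}`, `n ≥ 1`, is not singular with respect to
Haar measure on `G`. -/
def SpreadOut [IsTopologicalGroup G] [LocallyCompactSpace G] [BorelSpace G]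
    (μ : Measure G) : Prop :=
  ∃ n : ℕ, 1 ≤ n ∧ ¬ (convPow μ n).MutuallySingular Measure.haar

/-- `μ` is adapted: the closed subgroup generated by `supp μ` is all of `G`. -/
def Adapted [IsTopologicalGroup G] (μ : Measure G) : Prop :=
  (Subgroup.closure μ.support).topologicalClosure = ⊤

/-- `μ` is strongly adapted: the closed subsemigroup generated by `supp μ` is all of `G`. -/
def StronglyAdapted [IsTopologicalGroup G] (μ : Measure G) : Prop :=
  (Subsemigroup.closure μ.support).topologicalClosure = ⊤

/-- `X = G ⧸ Γ` has finite volume: it carries a nonzero finite `G`-invariant measure. -/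
def FiniteVolume (Γ : Subgroup G) : Prop :=
  ∃ m : Measure (G ⧸ Γ), m ≠ 0 ∧ IsFiniteMeasure m ∧ m.Regular ∧
    ∀ g : G, m.map (fun x => g • x) = m

/-- `μ` is `(G, Γ)`-adapted. -/
def PairAdapted [IsTopologicalGroup G] (Γ : Subgroup G) (μ : Measure G) : Prop :=
  (FiniteVolume Γ ∧ Adapted μ) ∨ StronglyAdapted μ

end Increments

section Walk

variable {G X : Type*} [Group G] [MeasurableSpace G] [MulAction G X] [MeasurableSpace X]

/-- The position `Φ_n = Y_n ⋯ Y_1 x` after `n` steps, when the increments are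
`Y_{k+1} = ω k`. -/
def position (ω : ℕ → G) (x : X) : ℕ → X
  | 0 => x
  | n + 1 => ω n • position ω x n

/-- The return probability `L(x, A) = ℙ_x[Φ_n ∈ A for some n ≥ 1]`, where the increments of the
walk are independent with common law `μ`. -/
def returnProb (μ : Measure G) (x : X) (A : Set X) : ℝ≥0∞ :=
  Measure.infinitePi (fun _ : ℕ => μ) {ω | ∃ n : ℕ, 1 ≤ n ∧ position ω x n ∈ A}

/-- `φ` is an irreducibility measure for the random walk on `X` given by `μ`. -/
def IsIrreducibilityMeasure (μ : Measure G) (φ : Measure X) : Prop :=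
  φ ≠ 0 ∧ ∀ A : Set X, MeasurableSet A → 0 < φ A → ∀ x : X, 0 < returnProb μ x A

/-- `ψ` is a maximal irreducibility measure, that is, the random walk on `X` given by `μ` is
`ψ`-irreducible. -/
def IsPsiIrreducible (μ : Measure G) (ψ : Measure X) : Prop :=
  IsProbabilityMeasure ψ ∧ IsIrreducibilityMeasure μ ψ ∧
    ∀ φ : Measure X, IsIrreducibilityMeasure μ φ → φ ≪ ψ

/-- The one-step law `P(x, ·) = μ * δ_x` of the random walk. -/
def transition (μ : Measure G) (x : X) : Measure X :=
  μ.map (fun g => g • x)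

/-- `ν` is `P`-subinvariant: `ν` is `σ`-finite and `ν P ≤ ν`. -/
def Subinvariant (μ : Measure G) (ν : Measure X) : Prop :=
  SigmaFinite ν ∧ ∀ A : Set X, MeasurableSet A → ∫⁻ x, transition μ x A ∂ν ≤ ν A

end Walk

section HaarClass

variable {G : Type*} [Group G] [TopologicalSpace G] [IsTopologicalGroup G]
  [LocallyCompactSpace G] [MeasurableSpace G]

/-- The modular character `Δ` of `G`, normalised by `m(A g) = Δ(g) m(A)` for left Haar measures
`m`. Mathlib's `modularCharacter` satisfies `m(A g⁻¹) = modularCharacter g * m(A)`, which is why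
an inverse appears. -/
def modularChar (g : G) : ℝ≥0 :=
  Measure.modularCharacter g⁻¹

/-- `m` is a measure `m_{X,χ}` on `X = G ⧸ Γ`: a nontrivial Radon measure with
`g_* m = χ(g) m` for all `g`, where `χ` is a continuous character of `G` extending the
restriction of the modular character to `Γ`. (A monoid homomorphism from a group to `ℝ≥0` only
takes positive values.) -/
structure IsQuasiHaar (Γ : Subgroup G) (χ : G →* ℝ≥0) (m : Measure (G ⧸ Γ)) : Prop where
  continuous_char : Continuous χ
  char_eq : ∀ γ ∈ Γ, χ γ = modularChar γ
  ne_zero : m ≠ 0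
  regular : m.Regular
  map_smul : ∀ g : G, m.map (fun x => g • x) = χ g • m

/-- The Haar measure class `[m_X]` on `X = G ⧸ Γ`: all measures which have the same null sets as
some `m_{X,χ}`. -/
def haarClass (Γ : Subgroup G) : Set (Measure (G ⧸ Γ)) :=
  {ν | ∃ (χ : G →* ℝ≥0) (m : Measure (G ⧸ Γ)), IsQuasiHaar Γ χ m ∧ ν ≪ m ∧ m ≪ ν}

/-- `[m_X]` is subinvariant: it contains a subinvariant measure. -/
def HaarClassSubinvariant (Γ : Subgroup G) (μ : Measure G) : Prop :=
  ∃ ν ∈ haarClass Γ, Subinvariant μ ν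

end HaarClass

end

section WellDefined

open Set

open scoped Pointwise

theorem secondCountableTopology_of_sigmaCompact {G : Type*} [TopologicalSpace G] [SigmaCompactSpace G]
    [TopologicalSpace.MetrizableSpace G] : SecondCountableTopology G := by
  let := TopologicalSpace.metrizableSpaceMetric G
  infer_instance

theorem polishSpace {G : Type*} [Group G] [TopologicalSpace G] [IsTopologicalGroup G]
    [LocallyCompactSpace G] [SigmaCompactSpace G] [TopologicalSpace.MetrizableSpace G] :
    PolishSpace G := by
  have := secondCountableTopology_of_sigmaCompact (G := G)
  let := IsTopologicalGroup.rightUniformSpace G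
  have : IsRightUniformGroup G :=
    { uniformity_eq := by rw [uniformity_eq_comap_nhds_one'] }
  have : CompleteSpace G := IsRightUniformGroup.completeSpace_of_weaklyLocallyCompactSpace
  have : (uniformity G).IsCountablyGenerated := by
    rw [uniformity_eq_comap_nhds_one]; infer_instance
  infer_instance

/-- The quotient `σ`-algebra on `G ⧸ Γ`, which Mathlib uses, is the Borel `σ`-algebra. -/
theorem borelSpace_quotient {G : Type*} [Group G] [TopologicalSpace G] [IsTopologicalGroup G]
    [LocallyCompactSpace G] [SigmaCompactSpace G] [TopologicalSpace.MetrizableSpace G]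
    [MeasurableSpace G] [BorelSpace G]
    (Γ : Subgroup G) [DiscreteTopology Γ] : BorelSpace (G ⧸ Γ) := by
  have := polishSpace (G := G)
  have : IsClosed (Γ : Set G) := Subgroup.isClosed_of_discrete
  infer_instance

/-- A discrete subgroup has a Borel fundamental domain. -/
theorem exists_fundamentalDomain {G : Type*} [Group G] [TopologicalSpace G] [IsTopologicalGroup G]
    [LocallyCompactSpace G] [SigmaCompactSpace G] [TopologicalSpace.MetrizableSpace G]
    [MeasurableSpace G] [BorelSpace G]
    (Γ : Subgroup G) [DiscreteTopology Γ] : ∃ F : Set G, MeasurableSet F ∧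
      ∀ x : G, ∃! γ : Γ.op, γ • x ∈ F := by
  have := secondCountableTopology_of_sigmaCompact (G := G)
  obtain ⟨U, hU, -, hUΓ⟩ := IsDiscrete.exists_nhds_eq_one_of_image_mulRight_inter_nonempty Γ
    (isDiscrete_iff_discreteTopology.2 ‹_›)
  obtain ⟨s, hs, hsU⟩ := TopologicalSpace.countable_cover_nhds (α := G)
    (f := fun g => g • interior U) (fun g => by
      have : IsOpen (g • interior U) := isOpen_interior.smul g
      refine this.mem_nhds ⟨1, mem_interior_iff_mem_nhds.2 hU, by simp⟩)
  have hne : s.Nonempty := by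
    by_contra h
    rw [Set.not_nonempty_iff_eq_empty] at h
    subst h
    simp only [mem_empty_iff_false, iUnion_of_empty, iUnion_empty] at hsU
    exact Set.empty_ne_univ hsU
  obtain ⟨e, rfl⟩ := hs.exists_eq_range hne
  set V : ℕ → Set G := fun i => e i • interior U with hV
  have hVo : ∀ i, IsOpen (V i) := fun i => isOpen_interior.smul _
  have hVu : ∀ i x (γ : G), γ ∈ Γ → x ∈ V i → x * γ ∈ V i → γ = 1 := by
    rintro i x γ hγ ⟨u, hu, rfl⟩ ⟨v, hv, hv'⟩
    refine hUΓ γ hγ ⟨v, ⟨u, interior_subset hu, ?_⟩, interior_subset hv⟩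
    simp only [smul_eq_mul, mul_assoc] at hv'
    exact (mul_left_cancel hv').symm
  let W : ℕ → Set G := fun i => {x | ∃ γ ∈ Γ, x * γ ∈ V i}
  have hWo : ∀ i, IsOpen (W i) := by
    intro i
    have : W i = ⋃ γ ∈ Γ, (fun x => x * γ) ⁻¹' V i := by ext; simp [W]
    rw [this]
    exact isOpen_biUnion fun γ _ => (hVo i).preimage (continuous_mul_const γ)
  have hWinv : ∀ i x (γ : G), γ ∈ Γ → (x * γ ∈ W i ↔ x ∈ W i) := by
    intro i x γ hγ
    constructor
    · rintro ⟨δ, hδ, h⟩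
      exact ⟨γ * δ, Γ.mul_mem hγ hδ, by rwa [← mul_assoc]⟩
    · rintro ⟨δ, hδ, h⟩
      exact ⟨γ⁻¹ * δ, Γ.mul_mem (Γ.inv_mem hγ) hδ, by simpa [mul_assoc] using h⟩
  have hVW : ∀ i, V i ⊆ W i := fun i x hx => ⟨1, Γ.one_mem, by simpa using hx⟩
  have hcov : ∀ x, ∃ i, x ∈ W i := by
    intro x
    have : x ∈ ⋃ g ∈ range e, g • interior U := hsU ▸ mem_univ x
    simp only [mem_range, iUnion_exists, iUnion_iUnion_eq', mem_iUnion] at this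
    obtain ⟨i, hi⟩ := this
    exact ⟨i, hVW i hi⟩
  classical
  refine ⟨⋃ i, V i \ ⋃ j ∈ Finset.range i, W j, ?_, ?_⟩
  · refine MeasurableSet.iUnion fun i => (hVo i).measurableSet.diff ?_
    exact (isOpen_biUnion fun j _ => hWo j).measurableSet
  · intro x
    have key : ∀ γ ∈ Γ, (x * γ ∈ ⋃ i, V i \ ⋃ j ∈ Finset.range i, W j) ↔
        x * γ ∈ V (Nat.find (hcov x)) := by
      intro γ hγ
      simp only [mem_iUnion, mem_sdiff, Finset.mem_range, not_exists]
      constructor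
      · rintro ⟨i, hi, hj⟩
        have : Nat.find (hcov x) = i := by
          rw [Nat.find_eq_iff]
          exact ⟨(hWinv i x γ hγ).1 (hVW i hi), fun n hn h => hj n hn ((hWinv n x γ hγ).2 h)⟩
        rwa [this]
      · intro h
        exact ⟨_, h, fun j hj hx => Nat.find_min (hcov x) hj ((hWinv j x γ hγ).1 hx)⟩
    obtain ⟨γ, hγ, h⟩ := Nat.find_spec (hcov x)
    refine ⟨⟨MulOpposite.op γ, hγ⟩, (key γ hγ).2 h, ?_⟩
    rintro ⟨δ, hδ⟩ h'
    have h2 := (key δ.unop hδ).1 h'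
    have h3 := hVu _ (x * γ) (γ⁻¹ * δ.unop) (Γ.mul_mem (Γ.inv_mem hγ) hδ) h
      (by simpa [mul_assoc] using h2)
    have : δ.unop = γ := by rwa [inv_mul_eq_one, eq_comm] at h3
    ext
    simp [← this]

theorem continuous_modularCharacterFun {G : Type*} [Group G] [TopologicalSpace G] [IsTopologicalGroup G]
    [LocallyCompactSpace G] : Continuous (Measure.modularCharacterFun (G := G)) := by
  borelize G
  obtain ⟨⟨f, f_cont⟩, f_comp, f_nonneg, f_one⟩ :
    ∃ f : C(G, ℝ), HasCompactSupport f ∧ 0 ≤ f ∧ f 1 ≠ 0 := exists_continuous_nonneg_pos 1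
  let ν := Measure.haar (G := G)
  have h0 : ∫ x, f x ∂ν ≠ 0 :=
    ne_of_gt (f_cont.integral_pos_of_hasCompactSupport_nonneg_nonzero f_comp f_nonneg f_one)
  have : IsFiniteMeasureOnCompacts ν.inv := ⟨fun K hK => by
    rw [Measure.inv_apply]; exact hK.inv.measure_lt_top⟩
  have hc := continuous_integral_apply_inv_mul (μ := ν.inv) f_cont f_comp
  have key : ∀ g, (Measure.modularCharacterFun g : ℝ) =
      (∫ y, f (y⁻¹ * g) ∂ν.inv) / ∫ x, f x ∂ν := by
    intro g
    rw [Measure.modularCharacterFun_eq_haarScalarFactor ν,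
      Measure.haarScalarFactor_eq_integral_div _ _ f_cont f_comp h0, integral_map (by fun_prop)
      f_cont.aestronglyMeasurable, Measure.inv_def, integral_map (by fun_prop)
      (Continuous.aestronglyMeasurable (by fun_prop))]
    simp
  rw [NNReal.isEmbedding_coe.continuous_iff]
  simp only [Function.comp_def, key]
  exact hc.div_const _

theorem exists_isQuasiHaar {G : Type*} [Group G] [TopologicalSpace G] [IsTopologicalGroup G]
    [LocallyCompactSpace G] [SigmaCompactSpace G] [TopologicalSpace.MetrizableSpace G]
    [MeasurableSpace G] [BorelSpace G]
    (Γ : Subgroup G) [DiscreteTopology Γ] :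
    ∃ (χ : G →* ℝ≥0) (m : Measure (G ⧸ Γ)), IsQuasiHaar Γ χ m := by
  have := polishSpace (G := G)
  have := borelSpace_quotient Γ
  have hcl : IsClosed (Γ : Set G) := Subgroup.isClosed_of_discrete
  have : Countable Γ := TopologicalSpace.separableSpace_iff_countable.1 inferInstance
  have : Countable Γ.op := (Γ.equivOp).symm.countable_iff.2 inferInstance
  obtain ⟨F, hFm, hF⟩ := exists_fundamentalDomain Γ
  let ρ : Measure G := (Measure.haar (G := G)).inv
  have hfin : IsFiniteMeasureOnCompacts ρ := ⟨fun K hK => by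
    rw [Measure.inv_apply]; exact hK.inv.measure_lt_top⟩
  have hρ0 : ρ ≠ 0 := by
    intro h
    have h1 : ρ univ = 0 := by simp [h]
    rw [Measure.inv_apply] at h1
    simp only [Set.inv_univ, Measure.measure_univ_eq_zero] at h1
    exact NeZero.ne (Measure.haar (G := G)) h1
  have hfd : IsFundamentalDomain Γ.op F ρ := IsFundamentalDomain.mk' hFm.nullMeasurableSet hF
  have hπ : Measurable (QuotientGroup.mk : G → G ⧸ Γ) := by
    have : Continuous (QuotientGroup.mk : G → G ⧸ Γ) := QuotientGroup.continuous_mk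
    exact this.measurable
  have hinv : ∀ (A : Set (G ⧸ Γ)) (γ : Γ.op), (fun x : G => γ • x) ⁻¹' (QuotientGroup.mk ⁻¹' A) =
      QuotientGroup.mk ⁻¹' A := by
    rintro A ⟨γ, hγ⟩
    ext x
    have : (QuotientGroup.mk (x * γ.unop) : G ⧸ Γ) = QuotientGroup.mk x :=
      QuotientGroup.mk_mul_of_mem x hγ
    simp only [mem_preimage]
    change (QuotientGroup.mk (x * γ.unop) : G ⧸ Γ) ∈ A ↔ _
    rw [this]
  have hleft : ∀ (g : G) (A : Set G), ρ (g⁻¹ • A) = modularChar g * ρ A := by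
    intro g A
    have h := Measure.map_right_mul_eq_modularCharacterFun_smul (Measure.haar (G := G)) g⁻¹
    have h2 := congrArg (fun ν => ν A⁻¹) h
    simp only [Measure.smul_apply] at h2
    rw [(measurableEmbedding_mulRight g⁻¹).map_apply] at h2
    rw [Measure.inv_apply, Measure.inv_apply]
    have h3 : (g⁻¹ • A)⁻¹ = (fun x => x * g⁻¹) ⁻¹' A⁻¹ := by
      ext x; simp [Set.mem_smul_set_iff_inv_smul_mem]
    rw [h3, h2]
    rfl
  let m : Measure (G ⧸ Γ) := (ρ.restrict F).map QuotientGroup.mk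
  have hm : ∀ A, MeasurableSet A → m A = ρ (QuotientGroup.mk ⁻¹' A ∩ F) := by
    intro A hA
    rw [Measure.map_apply hπ hA, Measure.restrict_apply (hπ hA)]
  let χ : G →* ℝ≥0 :=
    { toFun := modularChar
      map_one' := by simp [modularChar]
      map_mul' := fun a b => by simp [modularChar, mul_comm] }
  have hlf : IsLocallyFiniteMeasure m := by
    refine ⟨fun x => ?_⟩
    obtain ⟨g, rfl⟩ := QuotientGroup.mk_surjective x
    obtain ⟨K, hK, hgK⟩ := exists_compact_mem_nhds g
    refine ⟨QuotientGroup.mk '' interior K,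
      (QuotientGroup.isOpenMap_coe _ isOpen_interior).mem_nhds
        ⟨g, mem_interior_iff_mem_nhds.2 hgK, rfl⟩, ?_⟩
    rw [hm _ (QuotientGroup.isOpenMap_coe _ isOpen_interior).measurableSet]
    refine lt_of_le_of_lt ?_ (hK.measure_lt_top (μ := ρ))
    rw [hfd.measure_eq_tsum K]
    refine le_trans (measure_mono ?_) (measure_iUnion_le _)
    rintro y ⟨⟨k, hk, hky⟩, hyF⟩
    rw [QuotientGroup.eq] at hky
    refine mem_iUnion.2 ⟨⟨MulOpposite.op (k⁻¹ * y), hky⟩, ⟨k, interior_subset hk, ?_⟩, hyF⟩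
    change k * (k⁻¹ * y) = y
    simp
  refine ⟨χ, m, ?_, fun γ _ => rfl, ?_, inferInstance, ?_⟩
  · exact continuous_modularCharacterFun.comp continuous_inv
  · intro h0
    have h1 : m univ = 0 := by simp [h0]
    rw [hm _ MeasurableSet.univ] at h1
    apply hρ0
    rw [← Measure.measure_univ_eq_zero]
    refine hfd.measure_zero_of_invariant univ (fun g => by simp) (by simpa using h1)
  · intro g
    ext A hA
    have hgm : Measurable (fun x : G ⧸ Γ => g • x) := (continuous_const_smul g).measurable
    rw [Measure.map_apply hgm hA, hm _ (hgm hA), Measure.smul_apply, hm _ hA]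
    have h1 : (QuotientGroup.mk ⁻¹' ((fun x : G ⧸ Γ => g • x) ⁻¹' A) ∩ F : Set G) =
        g⁻¹ • ((QuotientGroup.mk ⁻¹' A : Set G) ∩ g • F) := by
      ext x
      simp [Set.mem_smul_set_iff_inv_smul_mem]
    have hgF : IsFundamentalDomain Γ.op (g • F) ρ := by
      refine IsFundamentalDomain.mk' (hFm.const_smul g).nullMeasurableSet fun x => ?_
      have : ∀ γ : Γ.op, γ • x ∈ g • F ↔ γ • (g⁻¹ * x) ∈ F := by
        intro γ
        rw [Set.mem_smul_set_iff_inv_smul_mem, smul_eq_mul]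
        have : g⁻¹ * γ • x = γ • (g⁻¹ * x) := by
          rcases γ with ⟨γ, hγ⟩
          change g⁻¹ * (x * γ.unop) = g⁻¹ * x * γ.unop
          rw [mul_assoc]
        rw [this]
      simpa only [this] using hF (g⁻¹ * x)
    rw [h1, hleft, hgF.measure_set_eq hfd (hπ hA) (hinv A)]
    rfl

/-- The Haar measure class is not empty. -/
theorem haarClass_nonempty {G : Type*} [Group G] [TopologicalSpace G] [IsTopologicalGroup G]
    [LocallyCompactSpace G] [SigmaCompactSpace G] [TopologicalSpace.MetrizableSpace G]
    [MeasurableSpace G] [BorelSpace G]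
    (Γ : Subgroup G) [DiscreteTopology Γ] : (haarClass Γ).Nonempty := by
  obtain ⟨χ, m, h⟩ := exists_isQuasiHaar Γ
  exact ⟨m, χ, m, h, Measure.AbsolutelyContinuous.rfl, Measure.AbsolutelyContinuous.rfl⟩

end WellDefined

end HomogeneousWalk

/-! Everything is decided by Haar-null sets of `G`. A subset of `G ⧸ Γ` is null for the Haar class
iff its preimage is Haar null (`null_iff_of_quasiInvariant`), and it is almost surely never reached
from `x` iff no `μ^{*n}`, `n ≥ 1`, charges it after acting on `x` (`returnProb_eq_zero_iff`).

For (i), Fubini shows that a null set is never reached from almost every starting point, so an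
irreducibility measure does not charge it. If all powers `μ^{*n}` were singular, they would live on
a common Haar-null set; the walk from the identity coset would stay in the null image of that set
and never reach its complement, which has positive measure.

For (ii), let `F` be the set of points from which `A` is never reached. It is absorbing, so
`μ`-almost every `g` maps almost all of `F` into `F`. Such `g` form a closed semigroup, in finite
volume even a group, so adaptedness yields every `g ∈ G`, and `F` is null or conull. If `F` is
conull, then `A` is null. If `F` is null but contains a point, every `μ^{*n}` lives on a Haar-null
set, against spreading out. Hence nonzero measures that vanish on null sets are irreducibility
measures, and by the argument in (i) a probability measure in the Haar class is maximal. -/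

namespace HomogeneousWalk

/-! ### Reduction to the walk on the group -/

section Position

variable {G : Type*} [Group G]

theorem position_eq_smul {X : Type*} [MulAction G X] (ω : ℕ → G) (x : X)
    (n : ℕ) : position ω x n = position ω (1 : G) n • x := by
  induction n with
  | zero => exact (one_smul G x).symm
  | succ n ih => simp only [position, ih, smul_eq_mul, mul_smul]

theorem position_congr {ω ω' : ℕ → G} {n : ℕ} (h : ∀ i < n, ω i = ω' i) :
    position ω (1 : G) n = position ω' (1 : G) n := by
  induction n with
  | zero => rfl
  | succ n ih =>
    simp only [position, h n n.lt_succ_self, ih fun i hi => h i (hi.trans n.lt_succ_self)]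

end Position

/-! ### Convolution powers as laws of the walk -/

section Law

variable {G : Type*} [Group G] [MeasurableSpace G] [MeasurableMul₂ G]

/-- Fubini, with the right factor as outer variable: it stands for the earlier increments, on which
the later ones are conditioned. -/
theorem mconv_null_iff (μ ν : Measure G) [SFinite μ] [SFinite ν] {A : Set G}
    (hA : MeasurableSet A) : μ.mconv ν A = 0 ↔ ∀ᵐ h ∂ν, ∀ᵐ g ∂μ, g * h ∉ A := by
  have h1 : MeasurableSet {p : G × G | p.1 * p.2 ∉ A} := (measurable_mul hA).compl
  rw [← Measure.ae_ae_comm h1, Measure.mconv, Measure.map_apply measurable_mul hA,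
    Measure.measure_prod_null (measurable_mul hA), Filter.EventuallyEq]
  simp only [ae_iff, not_not, Pi.zero_apply]
  rfl

instance isProbabilityMeasure_convPow (μ : Measure G) [IsProbabilityMeasure μ] (n : ℕ) :
    IsProbabilityMeasure (convPow μ n) := by
  induction n with
  | zero => exact inferInstanceAs (IsProbabilityMeasure (Measure.dirac 1))
  | succ n ih => exact inferInstanceAs (IsProbabilityMeasure (μ.mconv (convPow μ n)))

theorem convPow_one (μ : Measure G) [IsProbabilityMeasure μ] : convPow μ 1 = μ :=
  Measure.mconv_dirac_one μ

theorem convPow_add (μ : Measure G) [IsProbabilityMeasure μ] (m n : ℕ) :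
    convPow μ (m + n) = (convPow μ m).mconv (convPow μ n) := by
  induction m with
  | zero =>
    rw [Nat.zero_add]
    exact (Measure.dirac_one_mconv _).symm
  | succ m ih =>
    rw [Nat.succ_add]
    change μ.mconv (convPow μ (m + n)) = (μ.mconv (convPow μ m)).mconv _
    rw [ih, Measure.mconv_assoc]

theorem measurable_position (n : ℕ) : Measurable fun ω : ℕ → G => position ω (1 : G) n := by
  induction n with
  | zero => exact measurable_const
  | succ n ih => exact (measurable_pi_apply n).mul ih

/-- The increment `ω n` is independent of the position after `n` steps. -/
theorem indepFun_position (μ : Measure G) [IsProbabilityMeasure μ] (n : ℕ) :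
    ProbabilityTheory.IndepFun (fun ω : ℕ → G => ω n) (fun ω => position ω (1 : G) n)
      (Measure.infinitePi fun _ : ℕ => μ) := by
  have h := ProbabilityTheory.iIndepFun_infinitePi (P := fun _ : ℕ => μ)
    (X := fun _ g => g) (fun _ => measurable_id)
  have h2 := h.indepFun_finset {n} (Finset.range n) (by simp) (fun i => measurable_pi_apply i)
  -- Pads a finite block of increments to a sequence; the filler `1` never enters the first `n`
  -- steps.
  let e : (Finset.range n → G) → ℕ → G :=
    fun t i => if hi : i ∈ Finset.range n then t ⟨i, hi⟩ else 1
  have he : Measurable e := by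
    refine measurable_pi_lambda _ fun i => ?_
    by_cases hi : i ∈ Finset.range n
    · simp only [e, hi, dite_true]
      exact measurable_pi_apply _
    · simp only [e, hi, dite_false]
      exact measurable_const
  have hφ : Measurable fun t : ({n} : Finset ℕ) → G => t ⟨n, Finset.mem_singleton_self n⟩ :=
    measurable_pi_apply _
  have h3 := h2.comp (ψ := fun t => position (e t) (1 : G) n) hφ ((measurable_position n).comp he)
  convert h3 using 1
  · rfl
  · ext ω
    exact position_congr fun i hi => by simp [e, hi]

/-- The law of `Y_n ⋯ Y_1` is `μ^{*n}`. -/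
theorem map_position (μ : Measure G) [IsProbabilityMeasure μ] (n : ℕ) :
    (Measure.infinitePi fun _ : ℕ => μ).map (fun ω => position ω (1 : G) n) = convPow μ n := by
  induction n with
  | zero => simp [position, convPow]
  | succ n ih =>
    have h := ((ProbabilityTheory.indepFun_iff_map_prod_eq_prod_map_map
      (measurable_pi_apply n).aemeasurable (measurable_position n).aemeasurable).1
      (indepFun_position μ n))
    rw [ih, Measure.infinitePi_map_eval] at h
    change _ = (μ.prod (convPow μ n)).map _
    rw [← h]
    exact (Measure.map_map (g := fun p : G × G => p.1 * p.2)
      (f := fun ω : ℕ → G => (ω n, position ω (1 : G) n)) measurable_mul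
      ((measurable_pi_apply n).prodMk (measurable_position n))).symm

theorem returnProb_eq_zero_iff {X : Type*} [MulAction G X] [MeasurableSpace X] (μ : Measure G)
    [IsProbabilityMeasure μ] (x : X) {A : Set X} (hA : MeasurableSet {g : G | g • x ∈ A}) :
    returnProb μ x A = 0 ↔ ∀ n, 1 ≤ n → convPow μ n {g | g • x ∈ A} = 0 := by
  have h : {ω : ℕ → G | ∃ n : ℕ, 1 ≤ n ∧ position ω x n ∈ A} =
      ⋃ n : ℕ, ⋃ _ : 1 ≤ n, {ω | position ω x n ∈ A} := by
    ext; simp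
  rw [returnProb, h, measure_iUnion_null_iff]
  refine forall_congr' fun n => ?_
  rw [measure_iUnion_null_iff]
  refine forall_congr' fun _ => ?_
  rw [← map_position μ n, Measure.map_apply (measurable_position n) hA]
  simp only [Set.preimage_ofPred_eq, ← position_eq_smul]

/-- The set of points from which `A` is never reached is absorbing. -/
theorem ae_forall_convPow_eq_zero {X : Type*} [MulAction G X] (μ : Measure G)
    [IsProbabilityMeasure μ] {x : X} {A : Set X} (hA : MeasurableSet {g : G | g • x ∈ A})
    (h : ∀ n, 1 ≤ n → convPow μ n {g | g • x ∈ A} = 0) (k : ℕ) :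
    ∀ᵐ g ∂convPow μ k, ∀ n, 1 ≤ n → convPow μ n {h | h • g • x ∈ A} = 0 := by
  rw [ae_all_iff]
  intro n
  rw [Filter.eventually_imp_distrib_left]
  intro hn
  -- Splits a path of length `n + k` after its first `k` steps.
  have h1 := h (n + k) (by omega)
  rw [convPow_add, mconv_null_iff _ _ hA] at h1
  simpa only [ae_iff, Set.mem_ofPred_eq, mul_smul, not_not] using h1

end Law

/-! ### Null sets on the quotient, and part (i) -/

section Quotient

variable {G : Type*} [Group G] [TopologicalSpace G] [IsTopologicalGroup G]
  [LocallyCompactSpace G] [SecondCountableTopology G] [MeasurableSpace G] [BorelSpace G]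
  {Γ : Subgroup G} [BorelSpace (G ⧸ Γ)]

omit [IsTopologicalGroup G] [LocallyCompactSpace G] [SecondCountableTopology G] in
theorem measurable_quotientMk : Measurable (QuotientGroup.mk : G → G ⧸ Γ) := by
  have : Continuous (QuotientGroup.mk : G → G ⧸ Γ) := QuotientGroup.continuous_mk
  exact this.measurable

omit [LocallyCompactSpace G] in
theorem measurable_smul_quotient : Measurable fun p : G × (G ⧸ Γ) => p.1 • p.2 :=
  (continuous_smul (M := G) (X := G ⧸ Γ)).measurable

omit [LocallyCompactSpace G] in
theorem measurableSet_smul_mem {A : Set (G ⧸ Γ)} (hA : MeasurableSet A) (x : G ⧸ Γ) :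
    MeasurableSet {g : G | g • x ∈ A} :=
  measurable_smul_quotient.comp (measurable_id.prodMk measurable_const) hA

omit [BorelSpace (G ⧸ Γ)] in
theorem haar_smul_mem_null_iff (A : Set (G ⧸ Γ)) (h : G) :
    Measure.haar {g : G | g • (h : G ⧸ Γ) ∈ A} = 0 ↔
      Measure.haar (QuotientGroup.mk ⁻¹' A : Set G) = 0 :=
  measure_mul_right_null Measure.haar (s := (QuotientGroup.mk ⁻¹' A : Set G)) h

/-- All nonzero quasi-invariant measures on `G ⧸ Γ` have the null sets given by Haar measure. -/
theorem null_iff_of_quasiInvariant {m : Measure (G ⧸ Γ)} [SFinite m] (h0 : m ≠ 0)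
    (hq : ∀ (g : G) (A : Set (G ⧸ Γ)), MeasurableSet A → m A = 0 → m {x | g • x ∈ A} = 0)
    {A : Set (G ⧸ Γ)} (hA : MeasurableSet A) :
    m A = 0 ↔ Measure.haar (QuotientGroup.mk ⁻¹' A : Set G) = 0 := by
  have hne : (ae m).NeBot := ae_neBot.2 h0
  have hp : MeasurableSet {p : G × (G ⧸ Γ) | p.1 • p.2 ∉ A} := (measurable_smul_quotient hA).compl
  -- Both directions compute the null set of pairs with `g • x ∈ A`: fixing `g` gives a translate of
  -- `A`, fixing `x` a right translate of its preimage.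
  have key := Measure.ae_ae_comm (μ := (Measure.haar : Measure G)) (ν := m)
    (p := fun g x => g • x ∉ A) hp
  constructor
  · intro h
    obtain ⟨x, hx⟩ := (key.1 (.of_forall fun g => by
      simpa [ae_iff] using hq g A hA h)).exists
    obtain ⟨h, rfl⟩ := QuotientGroup.mk_surjective x
    rw [← haar_smul_mem_null_iff A h]
    simpa [ae_iff] using hx
  · intro h
    obtain ⟨g, hg⟩ := (key.2 (.of_forall fun x => by
      obtain ⟨k, rfl⟩ := QuotientGroup.mk_surjective x
      simpa [ae_iff] using (haar_smul_mem_null_iff A k).2 h)).exists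
    have h2 := hq g⁻¹ {x | g • x ∈ A} ((measurable_const_smul g) hA) (by simpa [ae_iff] using hg)
    simpa using h2

theorem IsQuasiHaar.null_iff {χ : G →* ℝ≥0} {m : Measure (G ⧸ Γ)} (hm : IsQuasiHaar Γ χ m)
    {A : Set (G ⧸ Γ)} (hA : MeasurableSet A) :
    m A = 0 ↔ Measure.haar (QuotientGroup.mk ⁻¹' A : Set G) = 0 := by
  have := hm.regular
  have : SecondCountableTopology (G ⧸ Γ) := inferInstance
  have : SigmaFinite m := inferInstance
  refine null_iff_of_quasiInvariant hm.ne_zero (fun g A hA h => ?_) hA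
  have h1 := congrArg (fun ν : Measure (G ⧸ Γ) => ν A) (hm.map_smul g)
  simp only [Measure.map_apply (measurable_const_smul g) hA] at h1
  exact h1.trans (by simp [h])

theorem null_iff_of_mem_haarClass {m : Measure (G ⧸ Γ)} (hm : m ∈ haarClass Γ)
    {A : Set (G ⧸ Γ)} (hA : MeasurableSet A) :
    m A = 0 ↔ Measure.haar (QuotientGroup.mk ⁻¹' A : Set G) = 0 := by
  obtain ⟨χ, m', h, h1, h2⟩ := hm
  exact ⟨fun h0 => (h.null_iff hA).1 (h2 h0), fun h0 => h1 ((h.null_iff hA).2 h0)⟩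

/-- From almost every starting point, the walk never reaches a given null set. -/
theorem IsIrreducibilityMeasure.null_of_haar_null {μ : Measure G} [IsProbabilityMeasure μ]
    {φ : Measure (G ⧸ Γ)} (hφ : IsIrreducibilityMeasure μ φ) {A : Set (G ⧸ Γ)}
    (hA : MeasurableSet A) (h : Measure.haar (QuotientGroup.mk ⁻¹' A : Set G) = 0) : φ A = 0 := by
  have hB : MeasurableSet (QuotientGroup.mk ⁻¹' A : Set G) := measurable_quotientMk hA
  have h1 : ∀ᵐ x : G ∂(Measure.haar : Measure G), ∀ n, 1 ≤ n →
      convPow μ n {g | g • (x : G ⧸ Γ) ∈ A} = 0 := by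
    refine ae_all_iff.2 fun n => ?_
    have hp : MeasurableSet {p : G × G | p.1 * p.2 ∉ (QuotientGroup.mk ⁻¹' A : Set G)} :=
      (measurable_mul hB).compl
    have h2 := (Measure.ae_ae_comm (μ := convPow μ n) (ν := (Measure.haar : Measure G))
      (p := fun g x => g * x ∉ (QuotientGroup.mk ⁻¹' A : Set G)) hp).1
      (.of_forall fun g => by
        have := (measure_preimage_mul (Measure.haar : Measure G) g (QuotientGroup.mk ⁻¹' A)).trans h
        simp only [ae_iff, not_not]
        exact this)
    filter_upwards [h2] with x hx _
    simpa [ae_iff] using hx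
  obtain ⟨x, hx⟩ := h1.exists
  by_contra h2
  exact (hφ.2 A hA (pos_iff_ne_zero.2 h2) x).ne'
    ((returnProb_eq_zero_iff μ _ (measurableSet_smul_mem hA _)).2 hx)

theorem spreadOut_of_isIrreducibilityMeasure [Countable Γ] {μ : Measure G} [IsProbabilityMeasure μ]
    {φ : Measure (G ⧸ Γ)} (hφ : IsIrreducibilityMeasure μ φ) : SpreadOut μ := by
  by_contra hs
  simp only [SpreadOut, not_exists, not_and, not_not] at hs
  choose! S hSm hS hS' using hs
  -- Each power with `n ≥ 1` is carried by `(S n)ᶜ`, so `T` is a Haar-null set carrying all of them.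
  set T : Set G := ⋃ n : ℕ, ⋃ _ : 1 ≤ n, (S n)ᶜ with hT
  have hTm : MeasurableSet T :=
    MeasurableSet.iUnion fun n => MeasurableSet.iUnion fun hn => (hSm n hn).compl
  have hT0 : Measure.haar T = 0 :=
    measure_iUnion_null fun n => measure_iUnion_null fun hn => hS' n hn
  set A : Set (G ⧸ Γ) := QuotientGroup.mk '' T with hA
  -- Since `Γ` is countable, saturating `T` keeps it measurable and null.
  have hpre : (QuotientGroup.mk ⁻¹' A : Set G) = ⋃ γ : Γ, (fun x : G => x * γ) ⁻¹' T :=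
    QuotientGroup.preimage_image_mk Γ T
  have hAm : MeasurableSet A := by
    refine measurableSet_quotient.2 ?_
    change MeasurableSet (QuotientGroup.mk ⁻¹' A : Set G)
    rw [hpre]
    exact MeasurableSet.iUnion fun γ => measurable_mul_const (γ : G) hTm
  have hA0 : φ A = 0 := by
    refine hφ.null_of_haar_null hAm ?_
    rw [hpre]
    exact measure_iUnion_null fun γ => (measure_mul_right_null _ _).2 hT0
  have hAc : 0 < φ Aᶜ := by
    refine pos_iff_ne_zero.2 fun h => hφ.1 ?_
    rw [← Measure.measure_univ_eq_zero, ← Set.union_compl_self A]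
    exact measure_union_null hA0 h
  refine (hφ.2 _ hAm.compl hAc ((1 : G) : G ⧸ Γ)).ne'
    ((returnProb_eq_zero_iff μ _ (measurableSet_smul_mem hAm.compl _)).2 fun n hn => ?_)
  refine measure_mono_null (fun g hg => ?_) (hS n hn)
  by_contra hgS
  refine hg ⟨g, Set.mem_iUnion₂.2 ⟨n, hn, hgS⟩, ?_⟩
  change (g : G ⧸ Γ) = ((g * 1 : G) : G ⧸ Γ)
  rw [mul_one]

end Quotient

/-! ### Continuity of translation in measure -/

section Translates

open scoped Pointwise

variable {G : Type*} [Group G] [TopologicalSpace G] [IsTopologicalGroup G]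
  [LocallyCompactSpace G] [SecondCountableTopology G] [MeasurableSpace G] [BorelSpace G]

/-- By inner regularity the intersection contains a compact `K` of positive measure. For `t` near
`g`, the translate `(t⁻¹ * g) • K` still overlaps `K` in positive measure, and `t` sends it into `D`
because `g` sends `K` there. -/
theorem isOpen_setOf_haar_inter_pos [T2Space G] {C D : Set G} (hC : MeasurableSet C)
    (hD : MeasurableSet D) : IsOpen {g : G | 0 < Measure.haar (C ∩ {x | g * x ∈ D})} := by
  rw [isOpen_iff_mem_nhds]
  intro g hg
  have hm : MeasurableSet (C ∩ {x | g * x ∈ D}) := hC.inter (measurable_const_mul g hD)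
  obtain ⟨K, hKs, hK, hK0⟩ := hm.exists_lt_isCompact hg
  have h1 : Filter.Tendsto (fun t : G => t⁻¹ * g) (𝓝 g) (𝓝 1) := by
    have : Continuous fun t : G => t⁻¹ * g := by fun_prop
    simpa using this.tendsto g
  have h2 := h1.eventually (eventually_nhds_one_measure_smul_sdiff_lt
    (μ := (Measure.haar : Measure G)) hK hK.isClosed hK0.ne')
  filter_upwards [h2] with t ht
  have h3 : Measure.haar ((t⁻¹ * g) • K) = Measure.haar K := measure_smul _ _ _
  have h4 : 0 < Measure.haar (((t⁻¹ * g) • K) ∩ K) := by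
    refine pos_iff_ne_zero.2 fun h => ?_
    have := measure_inter_add_sdiff (μ := (Measure.haar : Measure G)) ((t⁻¹ * g) • K)
      hK.measurableSet
    rw [h, zero_add, h3] at this
    exact ht.ne this
  refine h4.trans_le (measure_mono ?_)
  rintro _ ⟨⟨k, hk, rfl⟩, hk'⟩
  refine ⟨(hKs hk').1, ?_⟩
  have := (hKs hk).2
  simpa [mul_assoc] using this

end Translates

/-! ### Almost stable elements and a zero-one law -/

section Stabilizer

variable {G : Type*} [Group G] [TopologicalSpace G] [IsTopologicalGroup G]
  [LocallyCompactSpace G] [SecondCountableTopology G] [MeasurableSpace G] [BorelSpace G]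

/-- The elements of `G` which map almost every point of `F` into `F`. -/
def aeStable (F : Set G) : Set G :=
  {g | Measure.haar (F ∩ {x | g * x ∈ Fᶜ}) = 0}

theorem isClosed_aeStable [T2Space G] {F : Set G} (hF : MeasurableSet F) :
    IsClosed (aeStable F) := by
  rw [← isOpen_compl_iff]
  convert isOpen_setOf_haar_inter_pos hF hF.compl using 1
  ext g
  simp [aeStable, pos_iff_ne_zero]

omit [SecondCountableTopology G] in
theorem mul_mem_aeStable {F : Set G} {g h : G} (hg : g ∈ aeStable F) (hh : h ∈ aeStable F) :
    g * h ∈ aeStable F := by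
  have h1 : Measure.haar ((fun x => h * x) ⁻¹' (F ∩ {x | g * x ∈ Fᶜ})) = 0 := by
    rw [measure_preimage_mul]
    exact hg
  refine measure_mono_null ?_ (measure_union_null hh h1)
  rintro x ⟨hx, hx'⟩
  by_cases hhx : h * x ∈ F
  · exact Or.inr ⟨hhx, by simpa [mul_assoc] using hx'⟩
  · exact Or.inl ⟨hx, hhx⟩

omit [SecondCountableTopology G] in
theorem one_mem_aeStable (F : Set G) : 1 ∈ aeStable F :=
  measure_mono_null (fun x hx => hx.2 (by simpa using hx.1)) measure_empty

/-- Ergodicity of left translation: if `F` is not null, Fubini gives one `x ∈ F` with `g * x ∈ F`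
for almost every `g`, and right translation preserves null sets. -/
theorem haar_null_or_compl_null {F : Set G} (hF : MeasurableSet F) (h : ∀ g, g ∈ aeStable F) :
    Measure.haar F = 0 ∨ Measure.haar Fᶜ = 0 := by
  refine or_iff_not_imp_left.2 fun h0 => ?_
  have hp : MeasurableSet {p : G × G | p.2 ∈ F → p.1 * p.2 ∈ F} :=
    (measurable_snd hF).imp (measurable_mul hF)
  have h1 := (Measure.ae_ae_comm (μ := (Measure.haar : Measure G))
    (ν := (Measure.haar : Measure G)) (p := fun g x => x ∈ F → g * x ∈ F) hp).1
    (.of_forall fun g => by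
      refine measure_mono_null ?_ (h g)
      intro x hx
      exact Classical.not_imp.1 hx)
  obtain ⟨x, hxF, hx⟩ := ((frequently_ae_mem_iff.2 h0).and_eventually h1).exists
  have h2 : Measure.haar {g : G | g * x ∈ Fᶜ} = 0 := by
    simpa [ae_iff, hxF] using hx
  exact (measure_mul_right_null Measure.haar (s := Fᶜ) x).1 h2

end Stabilizer

/-! ### Reachability, the core of part (ii) -/

section Reach

variable {G : Type*} [Group G] [TopologicalSpace G] [IsTopologicalGroup G]
  [LocallyCompactSpace G] [SecondCountableTopology G] [MeasurableSpace G] [BorelSpace G]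
  {Γ : Subgroup G} [BorelSpace (G ⧸ Γ)]

/-- In finite volume, the almost stable elements of a subset of `G ⧸ Γ` form a group. -/
theorem FiniteVolume.inv_mem_aeStable (hΓ : FiniteVolume Γ) {F : Set (G ⧸ Γ)}
    (hF : MeasurableSet F) {g : G} (hg : g ∈ aeStable (QuotientGroup.mk ⁻¹' F : Set G)) :
    g⁻¹ ∈ aeStable (QuotientGroup.mk ⁻¹' F : Set G) := by
  obtain ⟨m, h0, hfin, -, hinv⟩ := hΓ
  have hpre : ∀ (g : G) {A : Set (G ⧸ Γ)}, MeasurableSet A → m {x | g • x ∈ A} = m A := by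
    intro g A hA
    conv_rhs => rw [← hinv g, Measure.map_apply (measurable_const_smul g) hA]
    rfl
  have hnull : ∀ {A : Set (G ⧸ Γ)}, MeasurableSet A →
      (m A = 0 ↔ Measure.haar (QuotientGroup.mk ⁻¹' A : Set G) = 0) :=
    fun hA => null_iff_of_quasiInvariant h0 (fun g A hA h => (hpre g hA).trans h) hA
  have hmeas : ∀ (g : G) {A : Set (G ⧸ Γ)}, MeasurableSet A → MeasurableSet {x | g • x ∈ A} :=
    fun g A hA => measurable_const_smul g hA
  have h1 : m (F \ {x | g • x ∈ F}) = 0 :=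
    (hnull (hF.diff (hmeas g hF))).2 hg
  -- An almost inclusion between sets of equal finite measure is an almost equality.
  have h2 : F =ᵐ[m] {x | g • x ∈ F} :=
    ae_eq_of_ae_subset_of_measure_ge (ae_le_set.2 h1) (hpre g hF).le hF.nullMeasurableSet
      (measure_ne_top m _)
  have h3 : m ({x | g • x ∈ F} \ F) = 0 := ae_le_set.1 h2.symm.le
  have h4 : m {x | g⁻¹ • x ∈ {x | g • x ∈ F} \ F} = 0 :=
    (hpre g⁻¹ ((hmeas g hF).diff hF)).trans h3
  have h5 := (hnull (hmeas g⁻¹ ((hmeas g hF).diff hF))).1 h4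
  refine measure_mono_null ?_ h5
  rintro x ⟨hx, hx'⟩
  refine ⟨?_, hx'⟩
  change g • g⁻¹ • (x : G ⧸ Γ) ∈ F
  rwa [smul_inv_smul]

/-- Closedness passes from almost every `g` to the support. Strong adaptedness needs only the
semigroup property; plain adaptedness needs inverses, which finite volume supplies. -/
theorem PairAdapted.mem_aeStable [T2Space G] {μ : Measure G} (hμ : PairAdapted Γ μ)
    {F : Set (G ⧸ Γ)} (hF : MeasurableSet F)
    (h : ∀ᵐ g ∂μ, g ∈ aeStable (QuotientGroup.mk ⁻¹' F : Set G)) (g : G) :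
    g ∈ aeStable (QuotientGroup.mk ⁻¹' F : Set G) := by
  have hcl : IsClosed (aeStable (QuotientGroup.mk ⁻¹' F : Set G)) :=
    isClosed_aeStable (measurable_quotientMk hF)
  have hsupp := Measure.support_subset_of_isClosed hcl h
  rcases hμ with ⟨hΓ, hμ⟩ | hμ
  · let S : Subgroup G :=
      { carrier := aeStable (QuotientGroup.mk ⁻¹' F : Set G)
        mul_mem' := mul_mem_aeStable
        one_mem' := one_mem_aeStable _
        inv_mem' := hΓ.inv_mem_aeStable hF }
    have h1 : (Subgroup.closure μ.support).topologicalClosure ≤ S :=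
      Subgroup.topologicalClosure_minimal _ ((Subgroup.closure_le S).2 hsupp) hcl
    exact h1 (hμ.symm ▸ Subgroup.mem_top g)
  · let S : Subsemigroup G :=
      { carrier := aeStable (QuotientGroup.mk ⁻¹' F : Set G)
        mul_mem' := mul_mem_aeStable }
    have h1 : (Subsemigroup.closure μ.support).topologicalClosure ≤ S :=
      Subsemigroup.topologicalClosure_minimal _ (Subsemigroup.closure_le.2 hsupp) hcl
    exact h1 (hμ.symm ▸ Subsemigroup.mem_top g)

/-- A spread out and adapted walk reaches every set of positive Haar measure from everywhere. -/
theorem PairAdapted.exists_convPow_ne_zero [T2Space G] {μ : Measure G} [IsProbabilityMeasure μ]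
    (hμ : PairAdapted Γ μ) (hs : SpreadOut μ) {A : Set (G ⧸ Γ)} (hA : MeasurableSet A)
    (hA0 : Measure.haar (QuotientGroup.mk ⁻¹' A : Set G) ≠ 0) (x : G ⧸ Γ) :
    ∃ n, 1 ≤ n ∧ convPow μ n {g | g • x ∈ A} ≠ 0 := by
  set F : Set (G ⧸ Γ) := {x | ∀ n, 1 ≤ n → convPow μ n {g | g • x ∈ A} = 0} with hFdef
  have hFm : MeasurableSet F := by
    have : F = ⋂ n : ℕ, ⋂ _ : 1 ≤ n, {x | convPow μ n {g | g • x ∈ A} = 0} := by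
      ext; simp [F]
    rw [this]
    refine MeasurableSet.iInter fun n => MeasurableSet.iInter fun _ => ?_
    have hf : Measurable fun x : G ⧸ Γ => convPow μ n {g | g • x ∈ A} :=
      measurable_measure_prodMk_right (μ := convPow μ n) (measurable_smul_quotient hA)
    exact hf (measurableSet_singleton 0)
  have habs : ∀ x ∈ F, ∀ k, ∀ᵐ g ∂convPow μ k, g • x ∈ F := fun x hx k =>
    ae_forall_convPow_eq_zero μ (measurableSet_smul_mem hA x) hx k
  set E : Set G := QuotientGroup.mk ⁻¹' F with hE
  set B : Set G := QuotientGroup.mk ⁻¹' A with hB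
  have hEm : MeasurableSet E := measurable_quotientMk hFm
  have hBm : MeasurableSet B := measurable_quotientMk hA
  have hstable : ∀ᵐ g ∂μ, g ∈ aeStable E := by
    have hp : MeasurableSet {p : G × G | p.2 ∈ E → p.1 * p.2 ∈ E} :=
      (measurable_snd hEm).imp (measurable_mul hEm)
    have h1 := (Measure.ae_ae_comm (μ := μ) (ν := (Measure.haar : Measure G))
      (p := fun g x => x ∈ E → g * x ∈ E) hp).2
      (.of_forall fun y => by
        by_cases hy : y ∈ E
        · have := habs y hy 1
          rw [convPow_one] at this
          filter_upwards [this] with g hg _ using hg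
        · exact .of_forall fun g hy' => absurd hy' hy)
    filter_upwards [h1] with g hg
    rw [ae_iff] at hg
    refine measure_mono_null ?_ hg
    rintro z ⟨hz, hz'⟩ hzz
    exact hz' (hzz hz)
  rcases haar_null_or_compl_null hEm (hμ.mem_aeStable hFm hstable) with h0 | h0
  · by_contra! hx
    obtain ⟨n, hn, hsing⟩ := hs
    obtain ⟨h, rfl⟩ := QuotientGroup.mk_surjective x
    -- From a point of the absorbing set `F`, the `n`-step law does not charge `Fᶜ`, while Haar
    -- measure does not charge `F`.
    refine hsing ⟨{g | g • (h : G ⧸ Γ) ∈ Fᶜ}, measurableSet_smul_mem hFm.compl _, ?_, ?_⟩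
    · exact habs _ hx n
    · have := (haar_smul_mem_null_iff F h).2 h0
      convert this using 2
      ext g
      simp
  · exfalso
    have hp : MeasurableSet {p : G × G | p.1 * p.2 ∉ B} := (measurable_mul hBm).compl
    -- One step from almost every point misses `A`, so for some `g` the translate `g⁻¹B` is null,
    -- and hence `B` is.
    have h1 := (Measure.ae_ae_comm (μ := μ) (ν := (Measure.haar : Measure G))
      (p := fun g x => g * x ∉ B) hp).2 (by
        have : ∀ᵐ y ∂(Measure.haar : Measure G), y ∈ E := h0
        filter_upwards [this] with y hy
        have := hy 1 le_rfl
        rw [convPow_one] at this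
        simp only [ae_iff, not_not]
        exact this)
    obtain ⟨g, hg⟩ := h1.exists
    apply hA0
    rw [← measure_preimage_mul Measure.haar g]
    simp only [ae_iff, not_not] at hg
    exact hg

end Reach

end HomogeneousWalk

/-! ### The proposition -/

theorem mainTheorem8 {G : Type*} [Group G] [TopologicalSpace G] [IsTopologicalGroup G]
    [LocallyCompactSpace G] [SigmaCompactSpace G] [TopologicalSpace.MetrizableSpace G]
    [MeasurableSpace G] [BorelSpace G]
    (Γ : Subgroup G) [DiscreteTopology Γ]
    (μ : Measure G) [IsProbabilityMeasure μ] :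
    (∀ ψ : Measure (G ⧸ Γ), HomogeneousWalk.IsPsiIrreducible μ ψ →
      HomogeneousWalk.HaarClassSubinvariant Γ μ →
        HomogeneousWalk.SpreadOut μ ∧ ∀ m ∈ HomogeneousWalk.haarClass Γ, ψ ≪ m) ∧
    (HomogeneousWalk.SpreadOut μ → HomogeneousWalk.PairAdapted Γ μ →
      (∃ ψ : Measure (G ⧸ Γ), HomogeneousWalk.IsPsiIrreducible μ ψ) ∧
      ∀ ψ : Measure (G ⧸ Γ), HomogeneousWalk.IsPsiIrreducible μ ψ →
        ∀ m ∈ HomogeneousWalk.haarClass Γ, m ≪ ψ) := by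
  have := HomogeneousWalk.secondCountableTopology_of_sigmaCompact (G := G)
  have := HomogeneousWalk.borelSpace_quotient Γ
  have : Countable Γ := TopologicalSpace.separableSpace_iff_countable.1 inferInstance
  refine ⟨fun ψ hψ _ => ⟨HomogeneousWalk.spreadOut_of_isIrreducibilityMeasure hψ.2.1,
    fun m hm => Measure.AbsolutelyContinuous.mk fun A hA h =>
      hψ.2.1.null_of_haar_null hA ((HomogeneousWalk.null_iff_of_mem_haarClass hm hA).1 h)⟩,
    fun hs hμ => ?_⟩
  have hirr : ∀ φ : Measure (G ⧸ Γ), φ ≠ 0 →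
      (∀ A, MeasurableSet A → Measure.haar (QuotientGroup.mk ⁻¹' A : Set G) = 0 → φ A = 0) →
      HomogeneousWalk.IsIrreducibilityMeasure μ φ := by
    refine fun φ h0 hφ => ⟨h0, fun A hA hpos x => pos_iff_ne_zero.2 fun h => ?_⟩
    obtain ⟨n, hn, hne⟩ := hμ.exists_convPow_ne_zero hs hA (fun h => hpos.ne' (hφ A hA h)) x
    exact hne ((HomogeneousWalk.returnProb_eq_zero_iff μ x
      (HomogeneousWalk.measurableSet_smul_mem hA x)).1 h n hn)
  obtain ⟨χ, m₀, hm₀⟩ := HomogeneousWalk.exists_isQuasiHaar Γ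
  have := hm₀.regular
  have : NeZero m₀ := ⟨hm₀.ne_zero⟩
  -- `m₀.toFinite` is a probability measure with the null sets of `m₀`; it is maximal because
  -- irreducibility measures vanish on these.
  refine ⟨⟨m₀.toFinite, inferInstance, hirr _ (NeZero.ne _) fun A hA h =>
    toFinite_absolutelyContinuous m₀ ((hm₀.null_iff hA).2 h), fun φ hφ =>
      Measure.AbsolutelyContinuous.mk fun A hA h => hφ.null_of_haar_null hA
        ((hm₀.null_iff hA).1 (absolutelyContinuous_toFinite m₀ h))⟩, fun ψ hψ m hm => ?_⟩
  refine hψ.2.2 m (hirr m ?_ fun A hA h =>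
    (HomogeneousWalk.null_iff_of_mem_haarClass hm hA).2 h)
  rintro rfl
  obtain ⟨_, m', h, -, h'⟩ := hm
  exact h.ne_zero (Measure.absolutelyContinuous_zero_iff.1 h')
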